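/- Let $A\in\mathbb R^{n\times n}$ and $C_i\in\mathbb R^{s_i\times n}$, $i=1,\dots,m$, and consider the system $\dot x=Ax$, $y_i=C_ix$. Let $\mathcal V_i=\bigcap_{k=0}^{n-1}\ker (C_iA^k)$ be the unobservable space of $(C_i,A)$ and $P_i$ the orthogonal projection of $\mathbb R^n$ onto $\mathcal V_i$. Assume that the system is jointly observable, i.e. that the pair $(C,A)$ with $C=[C_1'\ \cdots\ C_m']'$ is observable. A time-varying neighbor graph $\mathbb N(t)$, $t\ge 0$, is a directed graph on $\{1,\dots,m\}$, depending on $t$ in an arbitrary way, with a self-arc at every vertex; $\mathcal N_i(t)$ is the set of all $j$ such that $\mathbb N(t)$ has an arc from $j$ to $i$, $m_i(t)=|\mathcal N_i(t)|$, and $S(t)$ is the row-stochastic matrix with entries $S_{ij}(t)=1/m_i(t)$ if $j\in\mathcal N_i(t)$ and $S_{ij}(t)=0$ otherwise. Then for every $\lambda>0$ there are a number $g^*>0$ and matrices $K_i\in\mathbb R^{n\times s_i}$, $i=1,\dots,m$, with the following property. For every $g\ge g^*$ and every time-varying neighbor graph $\mathbb N(t)$ such that, for all $t\ge 0$, $\mathbb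 N(t)$ is undirected and connected and $S(t)$ is doubly stochastic, and for every solution $x$ on $[0,\infty)$ of $\dot x=Ax$ and every solution $(x_1,\dots,x_m)$ on $[0,\infty)$ (locally absolutely continuous functions that satisfy the equations at almost every $t$) of $$\dot x_i=(A+K_iC_i)x_i-K_iy_i-gP_i\Big(x_i-\frac1{m_i(t)}\sum_{j\in\mathcal N_i(t)}x_j\Big),\qquad i=1,\dots,m,$$ each estimation error $x_i(t)-x(t)$ converges to zero as $t\to\infty$ as fast as $e^{-\lambda t}$ does: for each $i$ there is a constant $c$ with $\|x_i(t)-x(t)\|\le c\,e^{-\lambda t}$ for all $t\ge 0$. -/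

import Mathlib

open MeasureTheory

noncomputable section

/-- The unobservable space of the pair `(C, A)`: the kernel of the stacked matrix with blocks
`C, C A, …, C A ^ (n - 1)`. -/
def unobservableSpace {n : ℕ} {p : Type*} (C : Matrix p (Fin n) ℝ)
    (A : Matrix (Fin n) (Fin n) ℝ) : Submodule ℝ (EuclideanSpace ℝ (Fin n)) :=
  ⨅ k : Fin n, LinearMap.ker (Matrix.toEuclideanLin (C * A ^ (k : ℕ)))

/-- The pair `(C, A)` is observable. -/
def IsObservablePair {n : ℕ} {p : Type*} (C : Matrix p (Fin n) ℝ)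
    (A : Matrix (Fin n) (Fin n) ℝ) : Prop :=
  unobservableSpace C A = ⊥

/-- The matrix `C` obtained by stacking the output matrices `C_1, …, C_m`. -/
def stackedOutput {m n : ℕ} {s : Fin m → ℕ} (C : (i : Fin m) → Matrix (Fin (s i)) (Fin n) ℝ) :
    Matrix (Σ i : Fin m, Fin (s i)) (Fin n) ℝ :=
  Matrix.of fun p q => C p.1 p.2 q

/-- The multi-channel system `x' = A x`, `y_i = C_i x` is jointly observable. -/
def JointlyObservable {m n : ℕ} {s : Fin m → ℕ}
    (C : (i : Fin m) → Matrix (Fin (s i)) (Fin n) ℝ) (A : Matrix (Fin n) (Fin n) ℝ) : Prop :=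
  IsObservablePair (stackedOutput C) A

/-- The labels of the neighbors of agent `i`: there is an arc from `j` to `i` exactly when
`j` is a neighbor of `i`. -/
def neighbors {m : ℕ} (G : Digraph (Fin m)) (i : Fin m) : Finset (Fin m) :=
  letI := Classical.decPred fun j => G.Adj j i
  Finset.univ.filter fun j => G.Adj j i

/-- `G` is a neighbor graph: every agent is a neighbor of itself. -/
def IsNeighborGraph {m : ℕ} (G : Digraph (Fin m)) : Prop := ∀ i, G.Adj i i

/-- `G` is undirected: every arc comes with the reversed arc. -/
def IsUndirected {m : ℕ} (G : Digraph (Fin m)) : Prop := ∀ i j, G.Adj i j → G.Adj j i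

/-- Any two vertices of `G` are joined by a directed path; for an undirected graph this is
connectedness. -/
def IsConnectedGraph {m : ℕ} (G : Digraph (Fin m)) : Prop :=
  ∀ i j, Relation.ReflTransGen G.Adj i j

/-- The adjacency matrix of `G`: the entry `(i, j)` is `1` if there is an arc from `i` to `j`. -/
def adjacencyMatrix {m : ℕ} (G : Digraph (Fin m)) : Matrix (Fin m) (Fin m) ℝ :=
  letI := fun i => Classical.decPred fun j => G.Adj i j
  Matrix.of fun i j => if G.Adj i j then 1 else 0

/-- The in-degree of vertex `i`, which is the number of labels of neighbors of agent `i`. -/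
def inDegree {m : ℕ} (G : Digraph (Fin m)) (i : Fin m) : ℕ := (neighbors G i).card

/-- The stochastic matrix `S = D⁻¹ 𝒜'` of `G`, with `𝒜` the adjacency matrix and `D` the diagonal
matrix of in-degrees. -/
def stochasticMatrix {m : ℕ} (G : Digraph (Fin m)) : Matrix (Fin m) (Fin m) ℝ :=
  Matrix.diagonal (fun i => (inDegree G i : ℝ)⁻¹) * (adjacencyMatrix G).transpose

/-- `x` solves `x' = A x` on `[0, ∞)`. -/
def IsStateTrajectory {n : ℕ} (A : Matrix (Fin n) (Fin n) ℝ)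
    (x : ℝ → EuclideanSpace ℝ (Fin n)) : Prop :=
  ∀ t : ℝ, 0 ≤ t → HasDerivWithinAt x (Matrix.toEuclideanLin A (x t)) (Set.Ici 0) t

/-- The right-hand side of the private estimator of agent `i`, when the measured signal of agent
`i` is `y`, the estimates of all agents are `ξ` and the neighbor graph is `G`:
`(A + K_i C_i) ξ_i - K_i y - g P_i (ξ_i - (1 / m_i) ∑_{j ∈ 𝒩_i} ξ_j)`,
where `P_i` is the orthogonal projection on the unobservable space of `(C_i, A)`. -/
def estimatorField {m n : ℕ} {s : Fin m → ℕ} (A : Matrix (Fin n) (Fin n) ℝ)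
    (C : (i : Fin m) → Matrix (Fin (s i)) (Fin n) ℝ)
    (K : (i : Fin m) → Matrix (Fin n) (Fin (s i)) ℝ) (g : ℝ) (G : Digraph (Fin m))
    (i : Fin m) (y : EuclideanSpace ℝ (Fin (s i)))
    (ξ : Fin m → EuclideanSpace ℝ (Fin n)) : EuclideanSpace ℝ (Fin n) :=
  Matrix.toEuclideanLin (A + K i * C i) (ξ i) - Matrix.toEuclideanLin (K i) y
    - g • (unobservableSpace (C i) A).starProjection
        (ξ i - ((inDegree G i : ℝ)⁻¹) • ∑ j ∈ neighbors G i, ξ j)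

/-- `ξ` is a solution on `[0, ∞)` of the distributed estimator along the time-varying neighbor
graph `N`, driven by the outputs `y_i = C_i x`. As the graph may switch arbitrarily, solutions
are understood in the sense of Carathéodory: each estimate is locally absolutely continuous and
satisfies its differential equation at almost every time. -/
def IsEstimatorTrajectory {m n : ℕ} {s : Fin m → ℕ} (A : Matrix (Fin n) (Fin n) ℝ)
    (C : (i : Fin m) → Matrix (Fin (s i)) (Fin n) ℝ)
    (K : (i : Fin m) → Matrix (Fin n) (Fin (s i)) ℝ) (g : ℝ) (N : ℝ → Digraph (Fin m))
    (x : ℝ → EuclideanSpace ℝ (Fin n)) (ξ : Fin m → ℝ → EuclideanSpace ℝ (Fin n)) : Prop :=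
  ∀ i : Fin m,
    (∀ T : ℝ, 0 ≤ T → AbsolutelyContinuousOnInterval (ξ i) 0 T) ∧
    ∀ᵐ t ∂(volume.restrict (Set.Ici (0 : ℝ))),
      HasDerivAt (ξ i)
        (estimatorField A C K g (N t) i (Matrix.toEuclideanLin (C i) (x t)) fun j => ξ j t) t

end

/-! The errors `e i = ξ i - x` satisfy `e i' = M i (e i) - g P i (e i - ∑ j, S i j e j)` with `M i =
A + K i * C i`. The proof builds a quadratic Lyapunov function that treats separately the component
`P i (e i)` in the unobservable space and the complementary component.

The complementary component is handled locally. A weighted observability Gramian `W i` of `(C i, A)`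
vanishes exactly on the unobservable space, and `K i` can be chosen so that its quadratic form
decays at any prescribed rate (`exists_output_injection`). The coupling does not disturb this decay,
because `W i` kills the range of `P i`.

The unobservable components are handled by consensus. For doubly stochastic `S` the disagreement
form is half of `∑ S i j ‖w i - w j‖²`. If it vanishes on a connected graph, all `w i` are equal and
lie in the intersection of the unobservable spaces, which is zero by joint observability. So the
form is coercive, uniformly over the finitely many admissible graphs
(`exists_uniform_disagreement_bound`), and a large `g` dominates `M i`.

The sum `∑ ‖P i e i‖² + κ ⟪W i e i, e i⟫`, with `κ` large enough to absorb the cross terms, then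
decays like `exp (-2 λ t)`. It does not depend on the graph, so arbitrary switching is harmless. -/

/-! ### Absolute continuity and Lyapunov decay along Carathéodory solutions. -/

namespace AbsolutelyContinuousOnInterval

variable {E F ι : Type*} [NormedAddCommGroup E] [InnerProductSpace ℝ E]
  [NormedAddCommGroup F]

theorem clm_comp [NormedSpace ℝ F] {f : ℝ → E} {a b : ℝ} (T : E →L[ℝ] F)
    (hf : AbsolutelyContinuousOnInterval f a b) :
    AbsolutelyContinuousOnInterval (fun t => T (f t)) a b := by
  refine squeeze_zero (fun _ => Finset.sum_nonneg fun _ _ => dist_nonneg) (fun I => ?_)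
    (by simpa using Filter.Tendsto.const_mul ‖T‖ hf)
  rw [Finset.mul_sum]
  refine Finset.sum_le_sum fun i _ => ?_
  rw [dist_eq_norm, dist_eq_norm, ← map_sub]
  exact T.le_opNorm _

theorem inner_real {f g : ℝ → E} {a b : ℝ} (hf : AbsolutelyContinuousOnInterval f a b)
    (hg : AbsolutelyContinuousOnInterval g a b) :
    AbsolutelyContinuousOnInterval (fun t => inner ℝ (f t) (g t)) a b := by
  obtain ⟨c, hc⟩ := hf.exists_bound
  obtain ⟨d, hd⟩ := hg.exists_bound
  unfold AbsolutelyContinuousOnInterval at hf hg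
  refine squeeze_zero' (Filter.Eventually.of_forall fun _ =>
    Finset.sum_nonneg fun _ _ => dist_nonneg) ?_
    (by simpa using (hg.const_mul c).add (hf.const_mul d))
  rw [Filter.eventually_inf_principal]
  filter_upwards with I hI
  simp only [Finset.mul_sum, ← Finset.sum_add_distrib]
  refine Finset.sum_le_sum fun i hi => ?_
  have hp := hc _ (hI.1 i hi).1
  have hq := hd _ (hI.1 i hi).2
  set p := (I.2 i).1
  set q := (I.2 i).2
  have key : inner ℝ (f p) (g p) - inner ℝ (f q) (g q)
      = inner ℝ (f p) (g p - g q) + inner ℝ (f p - f q) (g q) := by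
    rw [inner_sub_right, inner_sub_left]; ring
  rw [Real.dist_eq, key, dist_eq_norm, dist_eq_norm]
  refine (abs_add_le _ _).trans (add_le_add ?_ ?_)
  · exact (abs_real_inner_le_norm _ _).trans (by gcongr)
  · rw [mul_comm d]
    exact (abs_real_inner_le_norm _ _).trans (by gcongr)

theorem finset_sum {f : ι → ℝ → F} {a b : ℝ} (s : Finset ι)
    (hf : ∀ i ∈ s, AbsolutelyContinuousOnInterval (f i) a b) :
    AbsolutelyContinuousOnInterval (fun t => ∑ i ∈ s, f i t) a b := by
  classical
  induction s using Finset.induction_on with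
  | empty =>
    simpa using (LipschitzOnWith.absolutelyContinuousOnInterval
      (f := fun _ : ℝ => (0 : F)) (K := 0) (LipschitzWith.const (0 : F)).lipschitzOnWith)
  | insert i s hi ih =>
    simp only [Finset.sum_insert hi]
    exact (hf i (Finset.mem_insert_self i s)).add
      (ih fun j hj => hf j (Finset.mem_insert_of_mem hj))

/-- An absolutely continuous function whose derivative is almost everywhere nonpositive does not
exceed its initial value. -/
theorem le_of_ae_hasDerivAt_nonpos {φ : ℝ → ℝ} {T : ℝ} (hT : 0 ≤ T)
    (hφ : AbsolutelyContinuousOnInterval φ 0 T)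
    (hd : ∀ᵐ t ∂(volume.restrict (Set.Ici (0 : ℝ))), ∃ d ≤ 0, HasDerivAt φ d t) :
    φ T ≤ φ 0 := by
  rw [← sub_nonpos, ← hφ.integral_deriv_eq_sub, intervalIntegral.integral_of_le hT]
  refine integral_nonpos_of_ae ?_
  have hsub : Set.Ioc (0 : ℝ) T ⊆ Set.Ici 0 := fun t ht => ht.1.le
  filter_upwards [ae_mono (Measure.restrict_mono hsub le_rfl) hd] with t ⟨d, hd0, hdt⟩
  simpa [hdt.deriv] using hd0

end AbsolutelyContinuousOnInterval

/-- Exponential decay of a quadratic Lyapunov function along Carathéodory solutions. -/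
theorem sum_inner_le_exp_mul_of_ae_hasDerivAt {E ι : Type*} [NormedAddCommGroup E]
    [InnerProductSpace ℝ E] [Fintype ι] (H : ι → E →L[ℝ] E)
    (hH : ∀ i x y, inner ℝ (H i x) y = inner ℝ x (H i y)) (r : ℝ) (e v : ι → ℝ → E)
    (hac : ∀ i, ∀ T : ℝ, 0 ≤ T → AbsolutelyContinuousOnInterval (e i) 0 T)
    (hd : ∀ i, ∀ᵐ t ∂(volume.restrict (Set.Ici (0 : ℝ))), HasDerivAt (e i) (v i t) t)
    (hle : ∀ t : ℝ, 0 ≤ t → 2 * ∑ i, inner ℝ (H i (e i t)) (v i t)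
      ≤ -r * ∑ i, inner ℝ (H i (e i t)) (e i t)) (T : ℝ) (hT : 0 ≤ T) :
    ∑ i, inner ℝ (H i (e i T)) (e i T)
      ≤ (∑ i, inner ℝ (H i (e i 0)) (e i 0)) * Real.exp (-r * T) := by
  have hexp : AbsolutelyContinuousOnInterval (fun t => Real.exp (r * t)) 0 T :=
    ContDiffOn.absolutelyContinuousOnInterval (by fun_prop)
  have hL : AbsolutelyContinuousOnInterval
      (fun t => ∑ i, (inner ℝ (H i (e i t)) (e i t) : ℝ)) 0 T :=
    .finset_sum _ fun i _ => ((hac i T hT).clm_comp (H i)).inner_real (hac i T hT)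
  -- Grönwall with an integrating factor: `exp (r t)` times the quadratic form is absolutely
  -- continuous with nonpositive derivative almost everywhere.
  have key := (hexp.mul hL).le_of_ae_hasDerivAt_nonpos hT (by
    have hpos : ∀ᵐ t ∂(volume.restrict (Set.Ici (0 : ℝ))), 0 ≤ t :=
      ae_restrict_mem measurableSet_Ici
    filter_upwards [ae_all_iff.2 hd, hpos] with t ht ht0
    have h1 : HasDerivAt (fun t => Real.exp (r * t)) (Real.exp (r * t) * r) t := by
      simpa using ((hasDerivAt_id t).const_mul r).exp
    have h2 : HasDerivAt (fun t => ∑ i, (inner ℝ (H i (e i t)) (e i t) : ℝ))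
        (∑ i, (inner ℝ (H i (e i t)) (v i t) + inner ℝ (H i (v i t)) (e i t))) t :=
      HasDerivAt.fun_sum fun i _ => ((H i).hasFDerivAt.comp_hasDerivAt t (ht i)).inner ℝ (ht i)
    refine ⟨_, ?_, h1.mul h2⟩
    have h3 : ∑ i, ((inner ℝ (H i (e i t)) (v i t) : ℝ) + inner ℝ (H i (v i t)) (e i t))
        = 2 * ∑ i, inner ℝ (H i (e i t)) (v i t) := by
      rw [Finset.mul_sum]
      refine Finset.sum_congr rfl fun i _ => ?_
      rw [hH i (v i t), real_inner_comm]; ring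
    rw [h3]
    have := hle t ht0
    have hp := Real.exp_pos (r * t)
    nlinarith)
  simp only [Pi.mul_apply, mul_zero, Real.exp_zero, one_mul] at key
  rw [neg_mul, Real.exp_neg, ← div_eq_mul_inv, le_div_iff₀ (Real.exp_pos _), mul_comm]
  exact key

/-! ### Observability Gramian and output injection. -/

section Gramian

variable {E F : Type*} [NormedAddCommGroup E] [InnerProductSpace ℝ E] [FiniteDimensional ℝ E]
  [NormedAddCommGroup F] [InnerProductSpace ℝ F]

/-- `A` commutes with its exponential and is placed next to `x`, so the derivative is, up to sign,
the same function with `A x` for `x`, and differentiation can be iterated. -/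
theorem hasDerivAt_apply_exp_neg_smul (C : E →L[ℝ] F) (A : E →L[ℝ] E) (x : E) (t : ℝ) :
    HasDerivAt (fun t : ℝ => C (NormedSpace.exp (t • -A) x))
      (-C (NormedSpace.exp (t • -A) (A x))) t := by
  have h := hasDerivAt_exp_smul_const (𝕂 := ℝ) (-A) t
  have h1 := ((ContinuousLinearMap.apply ℝ E x).hasFDerivAt.comp_hasDerivAt t h)
  have h2 := C.hasFDerivAt.comp_hasDerivAt t h1
  refine h2.congr_deriv ?_
  rw [mul_neg, map_neg, map_neg]
  rfl

theorem continuous_apply_exp_neg_smul (C : E →L[ℝ] F) (A : E →L[ℝ] E) (x : E) :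
    Continuous (fun t : ℝ => C (NormedSpace.exp (t • -A) x)) :=
  continuous_iff_continuousAt.2 fun t => (hasDerivAt_apply_exp_neg_smul C A x t).continuousAt

theorem apply_exp_neg_smul_eq_zero (C : E →L[ℝ] F) (A : E →L[ℝ] E) (x : E)
    (hx : ∀ k : ℕ, C ((A ^ k) x) = 0) (t : ℝ) : C (NormedSpace.exp (t • -A) x) = 0 := by
  have h := NormedSpace.exp_series_hasSum_exp' (𝕂 := ℝ) (t • -A)
  have h1 := (h.mapL (ContinuousLinearMap.apply ℝ E x)).mapL C
  refine h1.unique ?_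
  convert hasSum_zero with k
  have : (t • -A) ^ k = (-t) ^ k • A ^ k := by
    rw [smul_neg, ← neg_smul, smul_pow]
  rw [this]
  simp only [map_smul, ContinuousLinearMap.apply_apply, hx, smul_zero]

theorem apply_pow_eq_zero_of_apply_exp_neg_smul (C : E →L[ℝ] F) (A : E →L[ℝ] E) (x : E)
    (hx : ∀ t ∈ Set.Icc (0 : ℝ) 1, C (NormedSpace.exp (t • -A) x) = 0) (k : ℕ) :
    C ((A ^ k) x) = 0 := by
  -- The induction runs on the open interval, where vanishing nearby forces a zero derivative;
  -- continuity then reaches `t = 0`.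
  have key : ∀ t ∈ Set.Ioo (0 : ℝ) 1, C (NormedSpace.exp (t • -A) ((A ^ k) x)) = 0 := by
    induction k with
    | zero => exact fun t ht => by simpa using hx t (Set.Ioo_subset_Icc_self ht)
    | succ k ih =>
      intro t ht
      have h1 := hasDerivAt_apply_exp_neg_smul C A ((A ^ k) x) t
      have h2 : HasDerivAt (fun t : ℝ => C (NormedSpace.exp (t • -A) ((A ^ k) x))) 0 t := by
        refine (hasDerivAt_const t (0 : F)).congr_of_eventuallyEq ?_
        filter_upwards [isOpen_Ioo.mem_nhds ht] with u hu using ih u hu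
      have h3 := h1.unique h2
      rw [pow_succ']
      simpa using h3
  have hcl := Set.EqOn.closure (g := fun _ => (0 : F)) key
    (continuous_apply_exp_neg_smul C A ((A ^ k) x)) continuous_const
  have h0 := hcl (x := 0) (by rw [closure_Ioo (by norm_num)]; simp)
  simpa using h0

/-- The finite-horizon weighted observability Gramian of a pair `(C, A)`. -/
theorem exists_observability_gramian [FiniteDimensional ℝ F] (C : E →L[ℝ] F) (A : E →L[ℝ] E)
    (μ : ℝ) :
    ∃ W : E →L[ℝ] E, (∀ x y, inner ℝ (W x) y = inner ℝ x (W y)) ∧ (∀ x, 0 ≤ inner ℝ (W x) x) ∧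
      (∀ x, 2 * inner ℝ (W x) (A x) ≤ ‖C x‖ ^ 2 - 2 * μ * inner ℝ (W x) x) ∧
      (∀ x, (∀ k : ℕ, C ((A ^ k) x) = 0) → W x = 0) ∧
      (∀ x, inner ℝ (W x) x = 0 → ∀ k : ℕ, C ((A ^ k) x) = 0) := by
  -- The Gramian is `W = ∫₀¹ Y* Y`. Running time backwards gives `⟪W x, A x⟫` a decay term `-μ ⟪W x,
  -- x⟫`, at the price of `‖C x‖²`, which output injection can cancel.
  let Y : ℝ → E →L[ℝ] F := fun t => Real.exp (-μ * t) • (C ∘L NormedSpace.exp (t • -A))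
  have hYapp : ∀ t x, Y t x = Real.exp (-μ * t) • C (NormedSpace.exp (t • -A) x) :=
    fun t x => rfl
  have hY : Continuous Y := by
    have h1 : Continuous fun t : ℝ => NormedSpace.exp (t • -A) :=
      continuous_iff_continuousAt.2 fun t => (hasDerivAt_exp_smul_const (𝕂 := ℝ) (-A) t).continuousAt
    have h2 : Continuous fun t : ℝ => C ∘L NormedSpace.exp (t • -A) :=
      ((ContinuousLinearMap.compL ℝ E E F) C).continuous.comp h1
    exact (by fun_prop : Continuous fun t : ℝ => Real.exp (-μ * t)).smul h2
  have hX : Continuous fun t => ContinuousLinearMap.adjoint (Y t) ∘L Y t :=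
    (ContinuousLinearMap.adjoint.continuous.comp hY).clm_comp hY
  let W : E →L[ℝ] E := ∫ t in (0 : ℝ)..1, ContinuousLinearMap.adjoint (Y t) ∘L Y t
  have hWapp : ∀ x, W x = ∫ t in (0 : ℝ)..1, ContinuousLinearMap.adjoint (Y t) (Y t x) :=
    fun x => ContinuousLinearMap.intervalIntegral_apply (hX.intervalIntegrable 0 1) x
  have hW : ∀ x y, inner ℝ (W x) y = ∫ t in (0 : ℝ)..1, inner ℝ (Y t x) (Y t y) := by
    intro x y
    have hc : Continuous fun t => ContinuousLinearMap.adjoint (Y t) (Y t x) :=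
      hX.clm_apply continuous_const
    have h := (innerSL ℝ y).intervalIntegral_comp_comm (hc.intervalIntegrable (μ := volume) 0 1)
    rw [hWapp, real_inner_comm]
    rw [innerSL_apply_apply] at h
    rw [← h]
    refine intervalIntegral.integral_congr fun t _ => ?_
    simp only [innerSL_apply_apply]
    rw [ContinuousLinearMap.adjoint_inner_right, real_inner_comm]
  have hYx : ∀ x, Continuous fun t => Y t x := fun x => hY.clm_apply continuous_const
  refine ⟨W, fun x y => ?_, fun x => ?_, fun x => ?_, fun x hx => ?_, fun x hx => ?_⟩
  · rw [real_inner_comm (W y) x, hW, hW]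
    simp only [real_inner_comm]
  · rw [hW]
    exact intervalIntegral.integral_nonneg zero_le_one fun t _ => real_inner_self_nonneg
  · have hder : ∀ t ∈ Set.uIcc (0 : ℝ) 1, HasDerivAt (fun t => inner ℝ (Y t x) (Y t x))
        (-(2 * inner ℝ (Y t x) (Y t (A x)) + 2 * μ * inner ℝ (Y t x) (Y t x)) : ℝ) t := by
      intro t _
      have h1 : HasDerivAt (fun t => Real.exp (-μ * t)) (Real.exp (-μ * t) * -μ) t := by
        simpa using ((hasDerivAt_id t).const_mul (-μ)).exp
      have h2 : HasDerivAt (fun t => Y t x) (-(Y t (A x)) - μ • Y t x) t := by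
        refine (h1.smul (hasDerivAt_apply_exp_neg_smul C A x t)).congr_deriv ?_
        rw [hYapp, hYapp]
        module
      refine (h2.inner ℝ h2).congr_deriv ?_
      rw [inner_sub_left, inner_sub_right, inner_neg_left, inner_neg_right,
        real_inner_smul_left, real_inner_smul_right, real_inner_comm (Y t x) (Y t (A x))]
      ring
    have hci : Continuous fun t => (inner ℝ (Y t x) (Y t x) : ℝ) := (hYx x).inner (hYx x)
    have hcA : Continuous fun t => (inner ℝ (Y t x) (Y t (A x)) : ℝ) := (hYx x).inner (hYx _)
    -- Integrating the derivative of `‖Y t x‖²` gives the Lyapunov identity with boundary terms `‖Y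
    -- 1 x‖²`, which is dropped, and `‖Y 0 x‖² = ‖C x‖²`.
    have hftc := intervalIntegral.integral_eq_sub_of_hasDerivAt hder
      (((hcA.const_mul 2).add (hci.const_mul (2 * μ))).neg.intervalIntegrable 0 1)
    rw [intervalIntegral.integral_neg, intervalIntegral.integral_add
      ((hcA.const_mul 2).intervalIntegrable 0 1) ((hci.const_mul (2 * μ)).intervalIntegrable 0 1),
      intervalIntegral.integral_const_mul, intervalIntegral.integral_const_mul, ← hW, ← hW] at hftc
    have h0 : inner ℝ (Y 0 x) (Y 0 x) = ‖C x‖ ^ 2 := by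
      rw [hYapp]; simp
    have h1 : 0 ≤ inner ℝ (Y 1 x) (Y 1 x) := real_inner_self_nonneg
    linarith
  · rw [hWapp]
    simp only [hYapp, apply_exp_neg_smul_eq_zero C A x hx, smul_zero, map_zero,
      intervalIntegral.integral_zero]
  · refine apply_pow_eq_zero_of_apply_exp_neg_smul C A x fun t ht => ?_
    rw [hW] at hx
    have hci : Continuous fun t => (inner ℝ (Y t x) (Y t x) : ℝ) := (hYx x).inner (hYx x)
    have h0 : (inner ℝ (Y t x) (Y t x) : ℝ) = 0 := by
      by_contra hne
      have := intervalIntegral.integral_pos zero_lt_one hci.continuousOn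
        (fun s _ => real_inner_self_nonneg)
        ⟨t, ht, lt_of_le_of_ne real_inner_self_nonneg (Ne.symm hne)⟩
      exact this.ne' hx
    rw [inner_self_eq_zero, hYapp, smul_eq_zero] at h0
    exact h0.resolve_left (Real.exp_pos _).ne'

/-- On a subspace, a positive definite continuous quadratically homogeneous function dominates a
multiple of the squared norm. -/
theorem exists_pos_mul_sq_norm_le {G : Type*} [NormedAddCommGroup G] [NormedSpace ℝ G]
    [FiniteDimensional ℝ G] {f : G → ℝ} (hf : Continuous f)
    (hom : ∀ (r : ℝ) x, f (r • x) = r ^ 2 * f x) (U : Submodule ℝ G)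
    (hpos : ∀ x ∈ U, x ≠ 0 → 0 < f x) : ∃ ρ > 0, ∀ x ∈ U, ρ * ‖x‖ ^ 2 ≤ f x := by
  have := FiniteDimensional.proper ℝ G
  have hK : IsCompact (Metric.sphere (0 : G) 1 ∩ U) :=
    (isCompact_sphere 0 1).inter_right U.closed_of_finiteDimensional
  have hf0 : f 0 = 0 := by simpa using hom 0 0
  have hmain : ∃ ρ > 0, ∀ x ∈ Metric.sphere (0 : G) 1 ∩ U, ρ ≤ f x := by
    rcases (Metric.sphere (0 : G) 1 ∩ (U : Set G)).eq_empty_or_nonempty with h | h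
    · exact ⟨1, one_pos, by simp [h]⟩
    · obtain ⟨z, hz, hmin⟩ := hK.exists_isMinOn h hf.continuousOn
      refine ⟨f z, hpos z hz.2 ?_, fun x hx => hmin hx⟩
      rintro rfl
      simpa using hz.1
  obtain ⟨ρ, hρ, h⟩ := hmain
  refine ⟨ρ, hρ, fun x hx => ?_⟩
  rcases eq_or_ne x 0 with rfl | hx0
  · simp [hf0]
  have hn : 0 < ‖x‖ := norm_pos_iff.2 hx0
  have h1 := h (‖x‖⁻¹ • x) ⟨by simp [norm_smul, hn.ne'], U.smul_mem _ hx⟩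
  rw [hom, inv_pow, ← div_eq_inv_mul, le_div_iff₀ (by positivity)] at h1
  exact h1

/-- An output injection that makes the observable part of `(C, A)` decay at a prescribed rate,
certified by a quadratic form `W` that vanishes on the unobservable space `V`. -/
theorem exists_output_injection [FiniteDimensional ℝ F] (C : E →L[ℝ] F) (A : E →L[ℝ] E) (μ : ℝ)
    (V : Submodule ℝ E) (hV : ∀ x, x ∈ V ↔ ∀ k : ℕ, C ((A ^ k) x) = 0) :
    ∃ (K : F →L[ℝ] E) (W : E →L[ℝ] E), (∀ x y, inner ℝ (W x) y = inner ℝ x (W y)) ∧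
      (∀ x ∈ V, W x = 0) ∧
      (∀ x, 2 * inner ℝ (W x) (A x + K (C x)) ≤ - (2 * μ) * inner ℝ (W x) x) ∧
      ∃ c > 0, ∀ x, ‖x - V.starProjection x‖ ^ 2 ≤ c * inner ℝ (W x) x := by
  obtain ⟨W, hsymm, hnonneg, hdiss, hzero, hker⟩ := exists_observability_gramian C A μ
  have hWV : ∀ x ∈ V, W x = 0 := fun x hx => hzero x ((hV x).1 hx)
  have hWsymm : (W : E →ₗ[ℝ] E).IsSymmetric := hsymm
  -- `W` is symmetric, so its range is the orthogonal complement of its kernel; that kernel lies in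
  -- `ker C` (the case `k = 0` of `hker`).
  have hrange : ∀ y, ContinuousLinearMap.adjoint C y ∈ LinearMap.range (W : E →ₗ[ℝ] E) := by
    intro y
    rw [← Submodule.orthogonal_orthogonal (LinearMap.range (W : E →ₗ[ℝ] E)),
      hWsymm.orthogonal_range]
    intro v hv
    have hWv : W v = 0 := hv
    have hCv : C v = 0 := by simpa using hker v (by rw [hWv, inner_zero_left]) 0
    rw [ContinuousLinearMap.adjoint_inner_right, hCv, inner_zero_left]
  obtain ⟨L, hL⟩ := Module.projective_lifting_property (W : E →ₗ[ℝ] E).rangeRestrict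
    ((ContinuousLinearMap.adjoint C : F →ₗ[ℝ] E).codRestrict _ hrange)
    (LinearMap.surjective_rangeRestrict _)
  have hWL : ∀ y, W (L y) = ContinuousLinearMap.adjoint C y := fun y =>
    congrArg Subtype.val (LinearMap.congr_fun hL y)
  -- With `W L = C*`, the gain `-L / 2` contributes `-⟪W x, L (C x)⟫ = -‖C x‖²`, exactly cancelling
  -- the output term of `hdiss`.
  refine ⟨(-(1 / 2 : ℝ)) • LinearMap.toContinuousLinearMap L, W, hsymm, hWV, fun x => ?_, ?_⟩
  · have h1 : inner ℝ (W x) (L (C x)) = ‖C x‖ ^ 2 := by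
      rw [hsymm, hWL, ContinuousLinearMap.adjoint_inner_right, real_inner_self_eq_norm_sq]
    have h2 := hdiss x
    simp only [smul_apply, LinearMap.coe_toContinuousLinearMap',
      inner_add_right, real_inner_smul_right, h1]
    linarith
  · obtain ⟨ρ, hρ, h⟩ := exists_pos_mul_sq_norm_le (f := fun x => (inner ℝ (W x) x : ℝ))
      (W.continuous.inner continuous_id) (fun r x => by
        simp only [map_smul, real_inner_smul_left, real_inner_smul_right]; ring) Vᗮ (by
        intro x hx hx0
        refine lt_of_le_of_ne (hnonneg x) fun h0 => hx0 ?_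
        have hxV : x ∈ V := (hV x).2 (hker x h0.symm)
        exact inner_self_eq_zero.1 (hx x hxV))
    refine ⟨ρ⁻¹, inv_pos.2 hρ, fun x => ?_⟩
    have h1 := h _ (V.sub_starProjection_mem_orthogonal x)
    have h2 : W (V.starProjection x) = 0 := hWV _ (V.starProjection_apply_mem x)
    simp only [map_sub, h2, sub_zero, inner_sub_right] at h1
    rw [hsymm x (V.starProjection x), h2, inner_zero_right, sub_zero] at h1
    rw [← div_eq_inv_mul, le_div_iff₀ hρ, mul_comm]
    exact h1

end Gramian

/-! ### Disagreement form of a doubly stochastic matrix. -/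

section Consensus

theorem sum_sum_mul_left_of_mem_doublyStochastic {ι : Type*} [Fintype ι] [DecidableEq ι]
    {S : Matrix ι ι ℝ} (hS : S ∈ doublyStochastic ℝ ι) (f : ι → ℝ) :
    ∑ i, ∑ j, S i j * f i = ∑ i, f i :=
  Finset.sum_congr rfl fun i _ => by
    rw [← Finset.sum_mul, sum_row_of_mem_doublyStochastic hS i, one_mul]

theorem sum_sum_mul_right_of_mem_doublyStochastic {ι : Type*} [Fintype ι] [DecidableEq ι]
    {S : Matrix ι ι ℝ} (hS : S ∈ doublyStochastic ℝ ι) (f : ι → ℝ) :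
    ∑ i, ∑ j, S i j * f j = ∑ j, f j := by
  rw [Finset.sum_comm]
  exact Finset.sum_congr rfl fun i _ => by
    rw [← Finset.sum_mul, sum_col_of_mem_doublyStochastic hS i, one_mul]

variable {ι E : Type*} [Fintype ι] [DecidableEq ι] [NormedAddCommGroup E] [InnerProductSpace ℝ E]

/-- The disagreement form of a doubly stochastic matrix is a weighted sum of squared
differences. -/
theorem sum_inner_sub_sum_smul_eq {S : Matrix ι ι ℝ} (hS : S ∈ doublyStochastic ℝ ι)
    (w : ι → E) : 2 * ∑ i, inner ℝ (w i) (w i - ∑ j, S i j • w j)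
      = ∑ i, ∑ j, S i j * ‖w i - w j‖ ^ 2 := by
  have hsq : ∀ i j, S i j * ‖w i - w j‖ ^ 2
      = S i j * ‖w i‖ ^ 2 + S i j * ‖w j‖ ^ 2 - 2 * (S i j * inner ℝ (w i) (w j)) := by
    intro i j
    rw [norm_sub_sq_real]; ring
  simp only [hsq, Finset.sum_sub_distrib, Finset.sum_add_distrib,
    sum_sum_mul_left_of_mem_doublyStochastic hS fun i => ‖w i‖ ^ 2,
    sum_sum_mul_right_of_mem_doublyStochastic hS fun i => ‖w i‖ ^ 2, inner_sub_right, inner_sum,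
    real_inner_smul_right, real_inner_self_eq_norm_sq, ← Finset.mul_sum]
  ring

/-- Coercivity of the disagreement form on families of vectors taken from subspaces with trivial
intersection. -/
theorem exists_pos_mul_sum_sq_le_disagreement [FiniteDimensional ℝ E] {S : Matrix ι ι ℝ}
    (hS : S ∈ doublyStochastic ℝ ι)
    (hconn : ∀ i j, Relation.ReflTransGen (fun i j => 0 < S i j) i j) (V : ι → Submodule ℝ E)
    (hV : ⨅ i, V i = ⊥) :
    ∃ ρ > 0, ∀ w : ι → E, (∀ i, w i ∈ V i) →
      ρ * ∑ i, ‖w i‖ ^ 2 ≤ ∑ i, inner ℝ (w i) (w i - ∑ j, S i j • w j) := by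
  have hnn : ∀ (w : ι → E) i j, 0 ≤ S i j * ‖w i - w j‖ ^ 2 := fun w i j =>
    mul_nonneg (nonneg_of_mem_doublyStochastic hS) (sq_nonneg _)
  obtain ⟨ρ, hρ, h⟩ := exists_pos_mul_sq_norm_le
    (f := fun w : ι → E => ∑ i, inner ℝ (w i) (w i - ∑ j, S i j • w j))
    (by fun_prop) (fun r w => by
      simp only [Pi.smul_apply, smul_comm _ r, ← Finset.smul_sum, ← smul_sub,
        real_inner_smul_left, real_inner_smul_right, Finset.mul_sum]
      exact Finset.sum_congr rfl fun i _ => by ring)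
    (Submodule.pi Set.univ V) (by
      intro w hw hw0
      by_contra hle
      apply hw0
      have hsum := sum_inner_sub_sum_smul_eq hS w
      have hzero : ∑ i, ∑ j, S i j * ‖w i - w j‖ ^ 2 = 0 :=
        le_antisymm (by linarith [not_lt.1 hle])
          (Finset.sum_nonneg fun i _ => Finset.sum_nonneg fun j _ => hnn w i j)
      have hstep : ∀ i j, 0 < S i j → w i = w j := by
        intro i j hij
        rw [Finset.sum_eq_zero_iff_of_nonneg
          fun i _ => Finset.sum_nonneg fun j _ => hnn w i j] at hzero
        have h1 := hzero i (Finset.mem_univ i)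
        rw [Finset.sum_eq_zero_iff_of_nonneg fun j _ => hnn w i j] at h1
        have h2 := (mul_eq_zero.1 (h1 j (Finset.mem_univ j))).resolve_left hij.ne'
        exact sub_eq_zero.1 (norm_eq_zero.1 (pow_eq_zero_iff two_ne_zero |>.1 h2))
      have hall : ∀ i j, w i = w j := by
        intro i j
        induction hconn i j with
        | refl => rfl
        | tail _ hbc ih => exact ih.trans (hstep _ _ hbc)
      funext i
      have hmem : w i ∈ ⨅ j, V j :=
        (Submodule.mem_iInf _).2 fun j => hall j i ▸ hw j (Set.mem_univ j)
      rw [hV] at hmem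
      simpa using hmem)
  -- The norm on `ι → E` is the sup norm, hence the factor `card ι`; the `+ 1` covers empty `ι`.
  refine ⟨ρ / (Fintype.card ι + 1), by positivity, fun w hw => le_trans ?_ (h w fun i _ => hw i)⟩
  have h1 : ∑ i, ‖w i‖ ^ 2 ≤ Fintype.card ι * ‖w‖ ^ 2 := by
    refine (Finset.sum_le_sum fun i _ =>
      pow_le_pow_left₀ (norm_nonneg _) (norm_le_pi_norm w i) 2).trans ?_
    simp
  rw [div_mul_eq_mul_div, div_le_iff₀ (by positivity)]
  nlinarith [sq_nonneg ‖w‖]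

/-- The dissipation inequality behind the distributed estimator: `w` are the components of the
errors in the unobservable spaces, `z` the complementary components. -/
theorem sum_inner_estimator_le {S : Matrix ι ι ℝ} (hS : S ∈ doublyStochastic ℝ ι)
    (M : ι → E →L[ℝ] E) {a g ρ : ℝ} (ha : ∀ i, ‖M i‖ ≤ a) (w z : ι → E) (hg : 0 ≤ g)
    (horth : ∀ i, inner ℝ (w i) (z i) = 0)
    (hρ : ρ * ∑ i, ‖w i‖ ^ 2 ≤ ∑ i, inner ℝ (w i) (w i - ∑ j, S i j • w j)) :
    2 * ∑ i, inner ℝ (w i) (M i (w i + z i) - g • (w i + z i - ∑ j, S i j • (w j + z j)))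
      ≤ 2 * (a + 1 - g * ρ) * ∑ i, ‖w i‖ ^ 2 + (a ^ 2 + g ^ 2) * ∑ i, ‖z i‖ ^ 2 := by
  have hdecomp : ∑ i, inner ℝ (w i)
        (M i (w i + z i) - g • (w i + z i - ∑ j, S i j • (w j + z j)))
      = ∑ i, inner ℝ (w i) (M i (w i)) + ∑ i, inner ℝ (w i) (M i (z i))
        - g * ∑ i, inner ℝ (w i) (w i - ∑ j, S i j • w j)
        + ∑ i, ∑ j, S i j * (g * inner ℝ (w i) (z j)) := by
    rw [Finset.mul_sum, ← Finset.sum_add_distrib, ← Finset.sum_sub_distrib,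
      ← Finset.sum_add_distrib]
    refine Finset.sum_congr rfl fun i _ => ?_
    have hcross : ∑ j, S i j * (g * inner ℝ (w i) (z j))
        = g * inner ℝ (w i) (∑ j, S i j • z j) := by
      rw [inner_sum, Finset.mul_sum]
      exact Finset.sum_congr rfl fun j _ => by rw [real_inner_smul_right]; ring
    simp only [hcross, smul_add, Finset.sum_add_distrib, map_add, inner_sub_right,
      inner_add_right, real_inner_smul_right, horth i]
    ring
  have h1 : ∑ i, inner ℝ (w i) (M i (w i)) ≤ a * ∑ i, ‖w i‖ ^ 2 := by
    rw [Finset.mul_sum]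
    refine Finset.sum_le_sum fun i _ => (real_inner_le_norm _ _).trans ?_
    have h := (M i).le_of_opNorm_le (ha i) (w i)
    nlinarith [norm_nonneg (w i)]
  have h2 : 2 * ∑ i, inner ℝ (w i) (M i (z i)) ≤ ∑ i, ‖w i‖ ^ 2 + a ^ 2 * ∑ i, ‖z i‖ ^ 2 := by
    rw [Finset.mul_sum, Finset.mul_sum, ← Finset.sum_add_distrib]
    refine Finset.sum_le_sum fun i _ => ?_
    have h := (M i).le_of_opNorm_le (ha i) (z i)
    have h' := real_inner_le_norm (w i) (M i (z i))
    nlinarith [norm_nonneg (w i), sq_nonneg (‖w i‖ - a * ‖z i‖)]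
  -- Young's inequality under the weights `S i j`: row sums collapse the `w` terms and column sums
  -- the `z` terms. This bound and `h2` each cost one `∑ ‖w i‖²`, whence the `1` in `a + 1 - g * ρ`.
  have h3 : 2 * ∑ i, ∑ j, S i j * (g * inner ℝ (w i) (z j))
      ≤ ∑ i, ‖w i‖ ^ 2 + g ^ 2 * ∑ i, ‖z i‖ ^ 2 := by
    rw [← sum_sum_mul_left_of_mem_doublyStochastic hS fun i => ‖w i‖ ^ 2,
      ← sum_sum_mul_right_of_mem_doublyStochastic hS fun i => ‖z i‖ ^ 2]
    simp only [Finset.mul_sum, ← Finset.sum_add_distrib]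
    refine Finset.sum_le_sum fun i _ => Finset.sum_le_sum fun j _ => ?_
    have hSij : 0 ≤ S i j := nonneg_of_mem_doublyStochastic hS
    have h' : 2 * (g * inner ℝ (w i) (z j)) ≤ ‖w i‖ ^ 2 + g ^ 2 * ‖z j‖ ^ 2 := by
      have := mul_le_mul_of_nonneg_left (real_inner_le_norm (w i) (z j)) hg
      nlinarith [sq_nonneg (‖w i‖ - g * ‖z j‖)]
    nlinarith [mul_le_mul_of_nonneg_left h' hSij]
  rw [hdecomp]
  have h4 := mul_le_mul_of_nonneg_left hρ hg
  nlinarith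

end Consensus

/-! ### Unobservable spaces and neighbor graphs. -/

/-- Cayley–Hamilton: every power of `A` is a polynomial in `A` of degree below `n`. -/
theorem mem_unobservableSpace_iff {n : ℕ} {p : Type*} (C : Matrix p (Fin n) ℝ)
    (A : Matrix (Fin n) (Fin n) ℝ) (x : EuclideanSpace ℝ (Fin n)) :
    x ∈ unobservableSpace C A ↔ ∀ k : ℕ, Matrix.toEuclideanLin (C * A ^ k) x = 0 := by
  simp only [unobservableSpace, Submodule.mem_iInf, LinearMap.mem_ker]
  refine ⟨fun h k => ?_, fun h k => h k⟩
  -- For `n = 0` the characteristic polynomial is `1`, and the strict degree bound on the remainder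
  -- fails.
  rcases Nat.eq_zero_or_pos n with rfl | hn
  · rw [Subsingleton.elim x 0, map_zero]
  have : Nonempty (Fin n) := ⟨⟨0, hn⟩⟩
  have hdeg : (Polynomial.X ^ k %ₘ A.charpoly).natDegree < n := by
    have h1 := Polynomial.natDegree_modByMonic_lt (Polynomial.X ^ k) A.charpoly_monic (by
      intro h1
      have := A.charpoly_natDegree_eq_dim
      rw [h1, Polynomial.natDegree_one, Fintype.card_fin] at this
      omega)
    rwa [A.charpoly_natDegree_eq_dim, Fintype.card_fin] at h1
  rw [A.pow_eq_aeval_mod_charpoly, Polynomial.aeval_eq_sum_range' hdeg, Matrix.mul_sum, map_sum,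
    LinearMap.sum_apply]
  refine Finset.sum_eq_zero fun j hj => ?_
  rw [Matrix.mul_smul, map_smul, LinearMap.smul_apply, h ⟨j, Finset.mem_range.1 hj⟩, smul_zero]

/-- Turns joint observability into the trivial intersection that coercivity of the disagreement form
requires. -/
theorem unobservableSpace_stackedOutput {m n : ℕ} {s : Fin m → ℕ}
    (C : (i : Fin m) → Matrix (Fin (s i)) (Fin n) ℝ) (A : Matrix (Fin n) (Fin n) ℝ) :
    unobservableSpace (stackedOutput C) A = ⨅ i, unobservableSpace (C i) A := by
  ext x
  simp only [Submodule.mem_iInf, mem_unobservableSpace_iff]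
  have hentry : ∀ k (q : Σ i : Fin m, Fin (s i)),
      Matrix.toEuclideanLin (stackedOutput C * A ^ k) x q
        = Matrix.toEuclideanLin (C q.1 * A ^ k) x q.2 := fun k q => rfl
  constructor
  · intro h i k
    ext j
    rw [← hentry k ⟨i, j⟩, h k]; rfl
  · intro h k
    ext q
    rw [hentry k q, h q.1 k]; rfl

theorem stochasticMatrix_apply {m : ℕ} (G : Digraph (Fin m)) (i j : Fin m) :
    stochasticMatrix G i j = if j ∈ neighbors G i then (inDegree G i : ℝ)⁻¹ else 0 := by
  classical
  rw [stochasticMatrix, Matrix.diagonal_mul]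
  simp [adjacencyMatrix, neighbors]

theorem sum_stochasticMatrix_smul {m : ℕ} {E : Type*} [AddCommGroup E] [Module ℝ E]
    (G : Digraph (Fin m)) (i : Fin m) (w : Fin m → E) :
    ∑ j, stochasticMatrix G i j • w j = (inDegree G i : ℝ)⁻¹ • ∑ j ∈ neighbors G i, w j := by
  simp only [stochasticMatrix_apply, ite_smul, zero_smul, Finset.smul_sum]
  rw [← Finset.sum_filter]
  simp

theorem stochasticMatrix_pos {m : ℕ} {G : Digraph (Fin m)} {i j : Fin m} (h : G.Adj j i) :
    0 < stochasticMatrix G i j := by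
  have hj : j ∈ neighbors G i := by simp [neighbors, h]
  have hcard : 0 < inDegree G i := Finset.card_pos.2 ⟨j, hj⟩
  rw [stochasticMatrix_apply, if_pos hj]
  positivity

/-- Finiteness makes one coercivity constant serve all values of a switching graph. -/
instance {α : Type*} [Finite α] : Finite (Digraph α) :=
  Finite.of_injective (fun G : Digraph α => G.Adj) fun _ _ h => Digraph.ext h

/-- A coercivity constant for the disagreement form that serves all connected undirected neighbor
graphs with doubly stochastic matrix. -/
theorem exists_uniform_disagreement_bound {m : ℕ} {E : Type*} [NormedAddCommGroup E]
    [InnerProductSpace ℝ E] [FiniteDimensional ℝ E] (V : Fin m → Submodule ℝ E)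
    (hV : ⨅ i, V i = ⊥) :
    ∃ ρ > 0, ∀ G : Digraph (Fin m), IsUndirected G → IsConnectedGraph G →
      stochasticMatrix G ∈ doublyStochastic ℝ (Fin m) → ∀ w : Fin m → E, (∀ i, w i ∈ V i) →
      ρ * ∑ i, ‖w i‖ ^ 2 ≤ ∑ i, inner ℝ (w i) (w i - ∑ j, stochasticMatrix G i j • w j) := by
  -- A constant may always be decreased, so each graph's bound holds for all small `ρ > 0`; a finite
  -- intersection of such conditions replaces a minimum over graphs.
  have hev : ∀ᶠ ρ in nhdsWithin (0 : ℝ) (Set.Ioi 0), ∀ G : Digraph (Fin m), IsUndirected G →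
      IsConnectedGraph G → stochasticMatrix G ∈ doublyStochastic ℝ (Fin m) →
      ∀ w : Fin m → E, (∀ i, w i ∈ V i) →
      ρ * ∑ i, ‖w i‖ ^ 2 ≤ ∑ i, inner ℝ (w i) (w i - ∑ j, stochasticMatrix G i j • w j) := by
    refine Filter.eventually_all.2 fun G => ?_
    by_cases hG : IsUndirected G ∧ IsConnectedGraph G ∧
      stochasticMatrix G ∈ doublyStochastic ℝ (Fin m)
    · obtain ⟨hu, hc, hS⟩ := hG
      obtain ⟨ρ, hρ, h⟩ := exists_pos_mul_sum_sq_le_disagreement hS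
        (fun i j => Relation.ReflTransGen.mono
          (fun i j hij => stochasticMatrix_pos (hu i j hij)) _ _ (hc i j)) V hV
      filter_upwards [Ioo_mem_nhdsGT hρ] with r hr _ _ _ w hw
      exact (mul_le_mul_of_nonneg_right hr.2.le
        (Finset.sum_nonneg fun i _ => sq_nonneg _)).trans (h w hw)
    · exact Filter.Eventually.of_forall fun r hu hc hS => absurd ⟨hu, hc, hS⟩ hG
  obtain ⟨ρ, h, hρ⟩ := (hev.and self_mem_nhdsWithin).exists
  exact ⟨ρ, hρ, h⟩

/-! ### Trajectories, error equation and choice of gains. -/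

theorem IsStateTrajectory.hasDerivAt {n : ℕ} {A : Matrix (Fin n) (Fin n) ℝ}
    {x : ℝ → EuclideanSpace ℝ (Fin n)} (hx : IsStateTrajectory A x) {t : ℝ} (ht : 0 < t) :
    HasDerivAt x (Matrix.toEuclideanLin A (x t)) t :=
  (hx t ht.le).hasDerivAt (Ici_mem_nhds ht)

theorem IsStateTrajectory.absolutelyContinuousOnInterval {n : ℕ} {A : Matrix (Fin n) (Fin n) ℝ}
    {x : ℝ → EuclideanSpace ℝ (Fin n)} (hx : IsStateTrajectory A x) {T : ℝ} (hT : 0 ≤ T) :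
    AbsolutelyContinuousOnInterval x 0 T := by
  have hsub : Set.uIcc 0 T ⊆ Set.Ici 0 := by
    rw [Set.uIcc_of_le hT]; exact Set.Icc_subset_Ici_self
  have hc : ContinuousOn (fun t => Matrix.toEuclideanLin A (x t)) (Set.uIcc 0 T) := by
    intro t ht
    exact ((Matrix.toEuclideanLin A).toContinuousLinearMap.continuous.continuousAt
      |>.comp_continuousWithinAt ((hx t (hsub ht)).continuousWithinAt.mono hsub))
  obtain ⟨c, hc⟩ := isCompact_uIcc.exists_bound_of_continuousOn hc
  refine LipschitzOnWith.absolutelyContinuousOnInterval (K := c.toNNReal)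
    (Convex.lipschitzOnWith_of_nnnorm_hasDerivWithin_le (convex_uIcc 0 T)
      (fun t ht => (hx t (hsub ht)).mono hsub) fun t ht => ?_)
  rw [← NNReal.coe_le_coe, coe_nnnorm]
  exact (hc t ht).trans (Real.le_coe_toNNReal c)

/-- The estimation errors follow the unforced estimator equation. -/
theorem estimatorField_sub {m n : ℕ} {s : Fin m → ℕ} (A : Matrix (Fin n) (Fin n) ℝ)
    (C : (i : Fin m) → Matrix (Fin (s i)) (Fin n) ℝ)
    (K : (i : Fin m) → Matrix (Fin n) (Fin (s i)) ℝ) (g : ℝ) {G : Digraph (Fin m)}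
    (hS : stochasticMatrix G ∈ doublyStochastic ℝ (Fin m)) (i : Fin m)
    (x : EuclideanSpace ℝ (Fin n)) (ξ : Fin m → EuclideanSpace ℝ (Fin n)) :
    estimatorField A C K g G i (Matrix.toEuclideanLin (C i) x) ξ - Matrix.toEuclideanLin A x
      = Matrix.toEuclideanLin (A + K i * C i) (ξ i - x)
        - g • (unobservableSpace (C i) A).starProjection
          (ξ i - x - ∑ j, stochasticMatrix G i j • (ξ j - x)) := by
  -- Unit row sums let the common state `x` pass through the average.
  have h1 : ∑ j, stochasticMatrix G i j • (ξ j - x)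
      = (inDegree G i : ℝ)⁻¹ • ∑ j ∈ neighbors G i, ξ j - x := by
    simp only [smul_sub, Finset.sum_sub_distrib, sum_stochasticMatrix_smul, ← Finset.sum_smul,
      sum_row_of_mem_doublyStochastic hS i, one_smul]
  have h2 : Matrix.toEuclideanLin (A + K i * C i) x
      = Matrix.toEuclideanLin A x + Matrix.toEuclideanLin (K i) (Matrix.toEuclideanLin (C i) x) := by
    rw [map_add, LinearMap.add_apply, Matrix.toLpLin_mul_same]
    rfl
  rw [estimatorField, h1, map_sub _ (ξ i) x, h2]
  rw [show ξ i - x - ((inDegree G i : ℝ)⁻¹ • ∑ j ∈ neighbors G i, ξ j - x)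
    = ξ i - (inDegree G i : ℝ)⁻¹ • ∑ j ∈ neighbors G i, ξ j by abel]
  abel

/-- Output injections for all channels at once, with common constants. -/
theorem exists_output_injections {m n : ℕ} {s : Fin m → ℕ} (A : Matrix (Fin n) (Fin n) ℝ)
    (C : (i : Fin m) → Matrix (Fin (s i)) (Fin n) ℝ) (μ : ℝ) :
    ∃ (K : (i : Fin m) → Matrix (Fin n) (Fin (s i)) ℝ)
      (W : Fin m → EuclideanSpace ℝ (Fin n) →L[ℝ] EuclideanSpace ℝ (Fin n)),
      (∀ i x y, inner ℝ (W i x) y = inner ℝ x (W i y)) ∧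
      (∀ i, ∀ x ∈ unobservableSpace (C i) A, W i x = 0) ∧
      (∀ i x, 2 * inner ℝ (W i x) (Matrix.toEuclideanLin (A + K i * C i) x)
        ≤ - (2 * μ) * inner ℝ (W i x) x) ∧
      ∃ c > 0, ∀ i x, ‖x - (unobservableSpace (C i) A).starProjection x‖ ^ 2
        ≤ c * inner ℝ (W i x) x := by
  have key : ∀ i, ∃ (K : Matrix (Fin n) (Fin (s i)) ℝ)
      (W : EuclideanSpace ℝ (Fin n) →L[ℝ] EuclideanSpace ℝ (Fin n)),
      (∀ x y, inner ℝ (W x) y = inner ℝ x (W y)) ∧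
      (∀ x ∈ unobservableSpace (C i) A, W x = 0) ∧
      (∀ x, 2 * inner ℝ (W x) (Matrix.toEuclideanLin (A + K * C i) x)
        ≤ - (2 * μ) * inner ℝ (W x) x) ∧
      ∃ c > 0, ∀ x, ‖x - (unobservableSpace (C i) A).starProjection x‖ ^ 2
        ≤ c * inner ℝ (W x) x := by
    intro i
    have hpow : ∀ (k : ℕ) x, ((Matrix.toEuclideanLin A).toContinuousLinearMap ^ k) x
        = Matrix.toEuclideanLin (A ^ k) x := by
      intro k
      induction k with
      | zero => intro x; simp [Matrix.toLpLin_one]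
      | succ k ih =>
        intro x
        rw [pow_succ, pow_succ, Matrix.toLpLin_mul_same]
        exact ih _
    obtain ⟨K, W, h1, h2, h3, h4⟩ := exists_output_injection
      (Matrix.toEuclideanLin (C i)).toContinuousLinearMap
      (Matrix.toEuclideanLin A).toContinuousLinearMap μ (unobservableSpace (C i) A) (by
        intro x
        rw [mem_unobservableSpace_iff]
        refine forall_congr' fun k => ?_
        rw [hpow, Matrix.toLpLin_mul_same]
        rfl)
    refine ⟨Matrix.toEuclideanLin.symm (K : _ →ₗ[ℝ] _), W, h1, h2, fun x => ?_, h4⟩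
    rw [map_add, LinearMap.add_apply, Matrix.toLpLin_mul_same, LinearMap.comp_apply,
      LinearEquiv.apply_symm_apply]
    exact h3 x
  choose K W h1 h2 h3 c hc h4 using key
  -- The `1` keeps the common constant positive when `m = 0`.
  have hcs : ∀ i, c i ≤ 1 + ∑ j, c j := fun i => by
    have := Finset.single_le_sum (fun j _ => (hc j).le) (Finset.mem_univ i)
    linarith
  refine ⟨K, W, h1, h2, h3, 1 + ∑ j, c j, ?_, fun i x => (h4 i x).trans ?_⟩
  · have := Finset.sum_nonneg fun j (_ : j ∈ Finset.univ) => (hc j).le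
    linarith
  · refine mul_le_mul_of_nonneg_right (hcs i) ?_
    exact nonneg_of_mul_nonneg_right ((sq_nonneg _).trans (h4 i x)) (hc i)

/-! ### The Lyapunov argument for the estimator. -/

theorem theorem3 {m n : ℕ} {s : Fin m → ℕ} (A : Matrix (Fin n) (Fin n) ℝ)
    (C : (i : Fin m) → Matrix (Fin (s i)) (Fin n) ℝ) (hobs : JointlyObservable C A)
    (lam : ℝ) (hlam : 0 < lam) :
    ∃ gstar : ℝ, 0 < gstar ∧ ∃ K : (i : Fin m) → Matrix (Fin n) (Fin (s i)) ℝ,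
      ∀ g : ℝ, gstar ≤ g → ∀ N : ℝ → Digraph (Fin m),
        (∀ t : ℝ, 0 ≤ t → IsNeighborGraph (N t) ∧ IsUndirected (N t) ∧ IsConnectedGraph (N t) ∧
          stochasticMatrix (N t) ∈ doublyStochastic ℝ (Fin m)) →
        ∀ (x : ℝ → EuclideanSpace ℝ (Fin n)) (ξ : Fin m → ℝ → EuclideanSpace ℝ (Fin n)),
          IsStateTrajectory A x → IsEstimatorTrajectory A C K g N x ξ →
          ∀ i : Fin m, ∃ c : ℝ, ∀ t : ℝ, 0 ≤ t → ‖ξ i t - x t‖ ≤ c * Real.exp (-lam * t) := by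
  -- The extra `1` in the rate pays for the cross terms. The gains are fixed here, before `g` and
  -- the graph.
  obtain ⟨K, W, hWsymm, hWV, hWK, c, hc, hWc⟩ := exists_output_injections A C (lam + 1)
  let V : Fin m → Submodule ℝ (EuclideanSpace ℝ (Fin n)) := fun i => unobservableSpace (C i) A
  obtain ⟨ρ, hρ, hdis⟩ := exists_uniform_disagreement_bound V
    ((unobservableSpace_stackedOutput C A).symm.trans hobs)
  let M : Fin m → EuclideanSpace ℝ (Fin n) →L[ℝ] EuclideanSpace ℝ (Fin n) :=
    fun i => (Matrix.toEuclideanLin (A + K i * C i)).toContinuousLinearMap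
  set a := ∑ i, ‖M i‖ with ha_def
  have ha : ∀ i, ‖M i‖ ≤ a := fun i =>
    Finset.single_le_sum (fun j _ => norm_nonneg (M j)) (Finset.mem_univ i)
  have ha0 : 0 ≤ a := Finset.sum_nonneg fun i _ => norm_nonneg _
  -- This threshold makes the coefficient `a + 1 - g * ρ` of the consensus part at most `-lam`.
  refine ⟨(a + 1 + lam) / ρ, by positivity, K, fun g hg N hN x ξ hx hξ => ?_⟩
  have hg0 : 0 < g := lt_of_lt_of_le (by positivity) hg
  have hgρ : a + 1 + lam ≤ g * ρ := (div_le_iff₀ hρ).1 hg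
  -- Chosen so that the cross term `(a ^ 2 + g ^ 2) * ∑ ‖z i‖²` is at most `2 κ ∑ ⟪W i e i, e i⟫`,
  -- leaving `-2 (lam + 1) κ + 2 κ = -2 lam κ`. It may depend on `g`, since only the Lyapunov
  -- function uses it.
  set κ := (a ^ 2 + g ^ 2) * c / 2 with hκ_def
  have hκ : 0 < κ := by positivity
  let P : Fin m → EuclideanSpace ℝ (Fin n) →L[ℝ] EuclideanSpace ℝ (Fin n) :=
    fun i => (V i).starProjection
  let H : Fin m → EuclideanSpace ℝ (Fin n) →L[ℝ] EuclideanSpace ℝ (Fin n) :=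
    fun i => P i + κ • W i
  have hPsymm : ∀ i x y, inner ℝ (P i x) y = inner ℝ x (P i y) :=
    fun i x y => (V i).inner_starProjection_left_eq_right x y
  have hPP : ∀ i x, P i (P i x) = P i x := fun i x =>
    Submodule.starProjection_eq_self_iff.2 (Submodule.starProjection_apply_mem _ _)
  have hWP : ∀ i x, W i (P i x) = 0 := fun i x => hWV i _ (Submodule.starProjection_apply_mem _ _)
  have hHsymm : ∀ i x y, inner ℝ (H i x) y = inner ℝ x (H i y) := fun i x y => by
    simp only [H, add_apply, smul_apply, inner_add_left, inner_add_right,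
      real_inner_smul_left, real_inner_smul_right, hPsymm i x y, hWsymm i x y]
  have hHval : ∀ i y, inner ℝ (H i y) y = ‖P i y‖ ^ 2 + κ * inner ℝ (W i y) y := fun i y => by
    simp only [H, add_apply, smul_apply, inner_add_left, real_inner_smul_left]
    rw [← hPP i y, hPsymm, hPP, real_inner_self_eq_norm_sq]
  have hWnn : ∀ i y, 0 ≤ inner ℝ (W i y) y := fun i y =>
    nonneg_of_mul_nonneg_right ((sq_nonneg _).trans (hWc i y)) hc
  have hHnn : ∀ i y, 0 ≤ inner ℝ (H i y) y := fun i y => by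
    rw [hHval]; have := mul_nonneg hκ.le (hWnn i y); positivity
  have hnorm : ∀ i y, ‖y‖ ^ 2 ≤ (1 + c / κ) * inner ℝ (H i y) y := fun i y => by
    have h1 : ‖y‖ ^ 2 = ‖P i y‖ ^ 2 + ‖y - P i y‖ ^ 2 := by
      have horth : inner ℝ (P i y) (y - P i y) = 0 := by
        rw [hPsymm, map_sub, hPP, sub_self, inner_zero_right]
      have h := norm_add_sq_eq_norm_sq_add_norm_sq_of_inner_eq_zero _ _ horth
      rw [add_sub_cancel] at h
      nlinarith
    have h2 : ‖y - P i y‖ ^ 2 ≤ c * inner ℝ (W i y) y := hWc i y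
    have h3 : (1 + c / κ) * inner ℝ (H i y) y = ‖P i y‖ ^ 2 + c * inner ℝ (W i y) y
        + (κ * inner ℝ (W i y) y + c / κ * ‖P i y‖ ^ 2) := by
      rw [hHval]; field_simp; ring
    have h4 : 0 ≤ κ * inner ℝ (W i y) y + c / κ * ‖P i y‖ ^ 2 := by
      have := mul_nonneg hκ.le (hWnn i y); positivity
    linarith
  let e : Fin m → ℝ → EuclideanSpace ℝ (Fin n) := fun i t => ξ i t - x t
  let v : Fin m → ℝ → EuclideanSpace ℝ (Fin n) := fun i t =>
    M i (e i t) - g • P i (e i t - ∑ j, stochasticMatrix (N t) i j • e j t)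
  have hac : ∀ i, ∀ T : ℝ, 0 ≤ T → AbsolutelyContinuousOnInterval (e i) 0 T :=
    fun i T hT => ((hξ i).1 T hT).sub (hx.absolutelyContinuousOnInterval hT)
  have hd : ∀ i, ∀ᵐ t ∂(volume.restrict (Set.Ici (0 : ℝ))), HasDerivAt (e i) (v i t) t := by
    intro i
    -- The null set `{0}` is discarded, as the state has only a one-sided derivative there.
    have hpos : ∀ᵐ t ∂(volume.restrict (Set.Ici (0 : ℝ))), 0 < t := by
      rw [← Measure.restrict_congr_set Ioi_ae_eq_Ici]
      exact ae_restrict_mem measurableSet_Ioi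
    filter_upwards [(hξ i).2, hpos] with t ht ht0
    refine (ht.sub (hx.hasDerivAt ht0)).congr_deriv ?_
    exact estimatorField_sub A C K g (hN t ht0.le).2.2.2 i (x t) fun j => ξ j t
  have hle : ∀ t : ℝ, 0 ≤ t → 2 * ∑ i, inner ℝ (H i (e i t)) (v i t)
      ≤ -(2 * lam) * ∑ i, inner ℝ (H i (e i t)) (e i t) := by
    intro t ht
    obtain ⟨-, hu, hconn, hS⟩ := hN t ht
    -- `W i P i = 0` removes the coupling from the Gramian part, and `P i² = P i` absorbs the
    -- projection in the other part.
    have hsplit : ∀ i, inner ℝ (H i (e i t)) (v i t)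
        = inner ℝ (P i (e i t)) (M i (e i t) - g • (e i t -
            ∑ j, stochasticMatrix (N t) i j • e j t)) + κ * inner ℝ (W i (e i t)) (M i (e i t)) := by
      intro i
      simp only [H, v, add_apply, smul_apply, inner_add_left, real_inner_smul_left,
        inner_sub_right, real_inner_smul_right]
      rw [← hPsymm, hPP, hWsymm i (e i t) (P i _), hWP, inner_zero_right,
        inner_sub_right]
      ring
    have h1 := sum_inner_estimator_le hS M ha (fun i => P i (e i t))
      (fun i => e i t - P i (e i t)) hg0.le
      (fun i => by rw [hPsymm, map_sub, hPP, sub_self, inner_zero_right])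
      (hdis (N t) hu hconn hS _ fun i => Submodule.starProjection_apply_mem _ _)
    simp only [add_sub_cancel] at h1
    have h2 : 2 * ∑ i, inner ℝ (W i (e i t)) (M i (e i t))
        ≤ -(2 * (lam + 1)) * ∑ i, inner ℝ (W i (e i t)) (e i t) := by
      rw [Finset.mul_sum, Finset.mul_sum]
      exact Finset.sum_le_sum fun i _ => hWK i (e i t)
    have h3 : ∑ i, ‖e i t - P i (e i t)‖ ^ 2 ≤ c * ∑ i, inner ℝ (W i (e i t)) (e i t) := by
      rw [Finset.mul_sum]
      exact Finset.sum_le_sum fun i _ => hWc i (e i t)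
    have h4 : 0 ≤ ∑ i, ‖P i (e i t)‖ ^ 2 := Finset.sum_nonneg fun i _ => sq_nonneg _
    simp only [hsplit, hHval, Finset.sum_add_distrib, ← Finset.mul_sum]
    have h5 := mul_le_mul_of_nonneg_left h2 hκ.le
    have h6 := mul_le_mul_of_nonneg_left h3 (by positivity : 0 ≤ a ^ 2 + g ^ 2)
    have h7 := mul_le_mul_of_nonneg_right hgρ h4
    have h8 : (a ^ 2 + g ^ 2) * (c * ∑ i, inner ℝ (W i (e i t)) (e i t))
        = 2 * (κ * ∑ i, inner ℝ (W i (e i t)) (e i t)) := by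
      rw [hκ_def]; ring
    nlinarith
  set L₀ := ∑ i, inner ℝ (H i (e i 0)) (e i 0) with hL₀
  intro i
  refine ⟨Real.sqrt ((1 + c / κ) * L₀), fun t ht => ?_⟩
  have hL := sum_inner_le_exp_mul_of_ae_hasDerivAt H hHsymm (2 * lam) e v hac hd hle t ht
  have hi : inner ℝ (H i (e i t)) (e i t) ≤ ∑ j, inner ℝ (H j (e j t)) (e j t) :=
    Finset.single_le_sum (fun j _ => hHnn j (e j t)) (Finset.mem_univ i)
  have hL₀nn : 0 ≤ L₀ := Finset.sum_nonneg fun j _ => hHnn j (e j 0)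
  -- The quadratic form decays at rate `2 * lam`, so the norm decays at rate `lam`.
  refine le_of_sq_le_sq ?_ (by positivity)
  rw [mul_pow, Real.sq_sqrt (by positivity), ← Real.exp_nat_mul]
  have hexp : ((2 : ℕ) : ℝ) * (-lam * t) = -(2 * lam) * t := by push_cast; ring
  rw [hexp, mul_assoc]
  exact (hnorm i (e i t)).trans (mul_le_mul_of_nonneg_left (hi.trans hL) (by positivity))
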